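/- All groups are finite and all characters are complex. For an irreducible character $\chi$ of a group $G$ let $Z(\chi)=\{g\in G : |\chi(g)|=\chi(1)\}$ be its center. The group $G$ is called nested if for all irreducible characters $\chi,\psi$ of $G$ either $Z(\chi)\le Z(\psi)$ or $Z(\psi)\le Z(\chi)$; in that case the distinct centers of irreducible characters of $G$, written in decreasing order $G=X_0>X_1>\dots>X_n$, are called the chain of centers of $G$. Theorem. Let $p$ be a prime and let $G$ be a nonabelian nested $p$-group with chain of centers $G=X_0>X_1>\dots>X_n$. For $i=0,\dots,n$ let $d_i\ge 0$ be the real number with $d_i^2=|G:X_i|$. Suppose that $G'\le X_n$ (that is, since $X_n=Z(G)$, that $G$ has nilpotence class $2$). Then $$|[X_{i-1},G]:[X_i,G]|\le d_i\qquad\text{for all } i=1,\dots,n.$$ In particular, $|G'|\le d_1\cdots d_n$. -/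

import Mathlib

namespace NestedGroup

/-- `Irr(G)`: the set of characters of the irreducible complex representations of `G` of finite
dimension.  Up to isomorphism the underlying vector space is `ℂ ^ m`. -/
def Irr (G : Type*) [Group G] : Set (G → ℂ) :=
  {χ | ∃ (m : ℕ) (ρ : Representation ℂ G (Fin m → ℂ)), ρ.IsIrreducible ∧ χ = ρ.character}

/-- The center `Z(χ) = {g ∈ G : |χ(g)| = χ(1)}` of a character `χ`. -/
def charCenter {G : Type*} [Group G] (χ : G → ℂ) : Set G :=
  {g | ((‖χ g‖ : ℝ) : ℂ) = χ 1}

/-- `G` is nested: the centers of any two irreducible characters are comparable. -/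
def IsNested (G : Type*) [Group G] : Prop :=
  ∀ χ ∈ Irr G, ∀ ψ ∈ Irr G, charCenter χ ⊆ charCenter ψ ∨ charCenter ψ ⊆ charCenter χ

/-- `X 0 > X 1 > ⋯ > X n` is the chain of centers of `G`: it starts at `X 0 = G`, is strictly
decreasing, and its terms are exactly the centers of the irreducible characters of `G`. -/
structure IsChainOfCenters {G : Type*} [Group G] {n : ℕ} (X : Fin (n + 1) → Subgroup G) :
    Prop where
  zero_eq_top : X 0 = ⊤
  strictAnti : StrictAnti X
  exists_eq_of_mem_irr : ∀ χ ∈ Irr G, ∃ i, charCenter χ = (X i : Set G)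
  exists_mem_irr_eq : ∀ i, ∃ χ ∈ Irr G, charCenter χ = (X i : Set G)

end NestedGroup

/-! Fix consecutive terms `X > Y` of the chain. As `G` has class 2, commutators give an alternating
pairing of `V = G/Y` with values in `D = Z(G)/[Y,G]`. Let `A` be the image of `[X,G]` in `D`. A
linear character `l` of `D` pulls back to `Z(G)` and lies under an irreducible character, whose
center is the radical of `l([x,y])`. This center is a term of the chain containing `Y`, and if `l`
is nontrivial on `A` it does not contain `X`; hence it is `Y`. So every `l` nontrivial on `A` makes
the pairing on `V` nondegenerate.

This forces `|A|² ≤ |V|` (`card_sq_le_of_nondegenerate`): the pairing reduces to a `k`-dimensional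
space of alternating `r × r` matrices over `ZMod p` with all nonzero members invertible, where `|A|
= p^k` and `p^r ≤ |V|`. The generic determinant is the square of a polynomial of degree at most
`r/2` in `k` variables, with only the trivial zero, so Chevalley–Warning gives `2k ≤ r`. The bound
on `|G'|` follows by telescoping from `[G,G]` down to `[Z(G),G] = 1`. -/

/-! ### Spaces of alternating matrices over a finite field -/

/-- Splitting off a hyperbolic plane contributes a factor `c²` and leaves a smaller Schur
complement, again alternating. This avoids constructing the Pfaffian. The zero diagonal is a
separate hypothesis because of characteristic 2. -/
theorem Matrix.isSquare_det_of_isAlt {K : Type*} [Field K] (m : ℕ) :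
    ∀ {ι : Type} [Fintype ι] [DecidableEq ι] (M : Matrix ι ι K), Fintype.card ι = m →
      (∀ i, M i i = 0) → (∀ i j, M i j = -M j i) → IsSquare M.det := by
  induction m using Nat.strong_induction_on with
  | _ m ih =>
  intro ι _ _ M hm h0 hanti
  by_cases hM : ∀ i j, M i j = 0
  · obtain rfl : M = 0 := Matrix.ext hM
    cases isEmpty_or_nonempty ι
    · simp
    · simp [Matrix.det_zero]
  push Not at hM
  obtain ⟨a, b, hab⟩ := hM
  have hne : a ≠ b := by rintro rfl; exact hab (h0 a)
  let κ := {i : ι // i ≠ a ∧ i ≠ b}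
  let f : Fin 2 ⊕ κ → ι := Sum.elim ![a, b] Subtype.val
  have hf : Function.Bijective f := by
    constructor
    · refine Function.Injective.sumElim ?_ Subtype.val_injective ?_
      · intro x y h
        fin_cases x <;> fin_cases y <;> simp [hne, hne.symm] at h ⊢
      · rintro x ⟨y, hy⟩ h
        fin_cases x
        · exact hy.1 h.symm
        · exact hy.2 h.symm
    · intro i
      by_cases hia : i = a
      · exact ⟨.inl 0, by simp [f, hia]⟩
      by_cases hib : i = b
      · exact ⟨.inl 1, by simp [f, hib]⟩
      exact ⟨.inr ⟨i, hia, hib⟩, rfl⟩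
  let e : Fin 2 ⊕ κ ≃ ι := Equiv.ofBijective f hf
  have hcard : Fintype.card κ < m := by
    have := Fintype.card_congr e
    simp only [Fintype.card_sum, Fintype.card_fin] at this
    omega
  let M' := M.submatrix e e
  have h0' : ∀ i, M' i i = 0 := fun i => h0 _
  have hanti' : ∀ i j, M' i j = -M' j i := fun i j => hanti _ _
  let c := M a b
  have hP : M'.toBlocks₁₁ = !![0, c; -c, 0] := by
    ext i j
    fin_cases i <;> fin_cases j
    · exact h0 a
    · rfl
    · exact hanti b a
    · exact h0 b
  have hdetP : M'.toBlocks₁₁.det = c * c := by rw [hP, Matrix.det_fin_two_of]; ring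
  have hc : c ≠ 0 := hab
  let Q : Matrix (Fin 2) (Fin 2) K := !![0, -c⁻¹; c⁻¹, 0]
  have hQ : M'.toBlocks₁₁ * Q = 1 := by
    rw [hP]
    ext i j
    fin_cases i <;> fin_cases j <;> simp [Q, Matrix.mul_apply, hc]
  let _ : Invertible M'.toBlocks₁₁ := ⟨Q, mul_eq_one_comm.1 hQ, hQ⟩
  have hinv : ⅟(M'.toBlocks₁₁) = Q := rfl
  rw [← Matrix.det_submatrix_equiv_self e M]
  change IsSquare M'.det
  rw [← Matrix.fromBlocks_toBlocks M', Matrix.det_fromBlocks₁₁, hdetP, hinv]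
  refine IsSquare.mul ⟨c, rfl⟩ (ih _ hcard _ rfl ?_ ?_)
  · intro i
    have h1 := hanti' (.inr i) (.inl 0)
    have h2 := hanti' (.inr i) (.inl 1)
    simp [Matrix.mul_apply, Matrix.toBlocks₂₁, Matrix.toBlocks₁₂, Matrix.toBlocks₂₂, Q, h0',
      h1, h2]
    ring
  · intro i j
    have h1 := hanti' (.inr i) (.inl 0)
    have h2 := hanti' (.inr i) (.inl 1)
    have h3 := hanti' (.inr j) (.inl 0)
    have h4 := hanti' (.inr j) (.inl 1)
    have h5 := hanti' (.inr i) (.inr j)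
    simp [Matrix.mul_apply, Matrix.toBlocks₂₁, Matrix.toBlocks₁₂, Matrix.toBlocks₂₂, Q,
      h1, h2, h3, h4, h5]
    ring

open MvPolynomial in
theorem MvPolynomial.totalDegree_det_le {σ R ι : Type*} [CommRing R] [Fintype ι] [DecidableEq ι]
    (M : Matrix ι ι (MvPolynomial σ R)) (hM : ∀ i j, (M i j).totalDegree ≤ 1) :
    M.det.totalDegree ≤ Fintype.card ι := by
  rw [Matrix.det_apply]
  refine (totalDegree_finsetSum _ _).trans (Finset.sup_le fun s _ => ?_)
  refine (totalDegree_smul_le _ _).trans ((totalDegree_finsetProd _ _).trans ?_)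
  exact (Finset.sum_le_sum fun i _ => hM _ _).trans (by simp)

open MvPolynomial in
/-- A linear space of dimension `k` of alternating matrices of size `r` over a finite field, all of
whose nonzero members are invertible, satisfies `2 * k ≤ r`. -/
theorem Matrix.two_mul_le_of_isAlt_of_det_ne_zero {K : Type*} [Field K] [Finite K] {k r : ℕ}
    (hr : 0 < r) (M : Fin k → Matrix (Fin r) (Fin r) K) (h0 : ∀ j i, M j i i = 0)
    (hanti : ∀ j a b, M j a b = -M j b a)
    (hdet : ∀ t : Fin k → K, t ≠ 0 → (∑ j, t j • M j).det ≠ 0) : 2 * k ≤ r := by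
  classical
  cases nonempty_fintype K
  by_contra! hlt
  let F : Matrix (Fin r) (Fin r) (MvPolynomial (Fin k) K) :=
    Matrix.of fun a b => ∑ j, C (M j a b) * X j
  have hF : ∀ t, eval t F.det = (∑ j, t j • M j).det := by
    intro t
    rw [RingHom.map_det]
    congr 1
    ext a b
    simp [F, Matrix.sum_apply, mul_comm]
  have hFdeg : F.det.totalDegree ≤ r := by
    have h1 : ∀ a b, (F a b).totalDegree ≤ 1 := fun a b => by
      simp only [F, Matrix.of_apply]
      refine (totalDegree_finsetSum _ _).trans (Finset.sup_le fun j _ => ?_)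
      exact (totalDegree_mul _ _).trans (by simp)
    simpa using totalDegree_det_le F h1
  have hsq : IsSquare F.det := by
    let L := FractionRing (MvPolynomial (Fin k) K)
    have : IsSquare (F.map (algebraMap _ L)).det :=
      Matrix.isSquare_det_of_isAlt r _ (by simp) (fun i => by simp [F, h0]) fun a b => by
        rw [Matrix.map_apply, Matrix.map_apply, ← map_neg]
        congr 1
        simp only [F, Matrix.of_apply, ← Finset.sum_neg_distrib]
        exact Finset.sum_congr rfl fun j _ => by rw [hanti j a b]; simp
    obtain ⟨y, hy⟩ := this
    rw [← RingHom.mapMatrix_apply, ← RingHom.map_det] at hy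
    -- The square root lies a priori in the fraction field; the polynomial ring is integrally
    -- closed.
    obtain ⟨z, rfl⟩ := IsIntegrallyClosed.exists_algebraMap_eq_of_isIntegral_pow (R := MvPolynomial (Fin k) K)
      (x := y) (n := 2) two_pos (by rw [sq, ← hy]; exact isIntegral_algebraMap)
    exact ⟨z, IsFractionRing.injective _ L (by rw [hy, map_mul])⟩
  obtain ⟨g, hg⟩ := hsq
  have hgt : ∀ t, eval t g = 0 ↔ t = 0 := by
    intro t
    have h1 := hF t
    rw [hg, map_mul] at h1
    constructor
    · intro h
      by_contra ht
      exact hdet t ht (by rw [← h1, h, mul_zero])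
    · rintro rfl
      have : Nonempty (Fin r) := ⟨⟨0, hr⟩⟩
      simpa [Matrix.det_zero] using h1
  have hdeg : g.totalDegree < Fintype.card (Fin k) := by
    rw [Fintype.card_fin]
    by_cases hg0 : g = 0
    · rw [hg0, totalDegree_zero]; omega
    · rw [hg, totalDegree_mul_of_isDomain hg0 hg0] at hFdeg
      omega
  -- Chevalley–Warning: the number of zeros of `g` is divisible by the characteristic, yet `0` is
  -- the only zero.
  have hdvd := char_dvd_card_solutions (ringChar K) hdeg
  have hone : Fintype.card {x // eval x g = 0} = 1 := by
    rw [Fintype.card_eq_one_iff]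
    exact ⟨⟨0, (hgt 0).2 rfl⟩, fun y => Subtype.ext ((hgt _).1 y.2)⟩
  rw [hone] at hdvd
  exact CharP.ringChar_ne_one (R := K) (Nat.dvd_one.1 hdvd)

/-! ### Nondegenerate pairings on abelian `p`-groups -/

theorem ZMod.exists_stdAddChar_eq {p : ℕ} [NeZero p] {z : ℂˣ} (hz : z ^ p = 1) :
    ∃ m : ZMod p, ZMod.stdAddChar m = (z : ℂ) := by
  have hprim : IsPrimitiveRoot (ZMod.stdAddChar (1 : ZMod p)) p := by
    have h := Complex.isPrimitiveRoot_exp p (NeZero.ne p)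
    have := ZMod.stdAddChar_coe (N := p) 1
    simp only [Int.cast_one, mul_one] at this
    rwa [this]
  obtain ⟨i, -, hi⟩ := hprim.eq_pow_of_pow_eq_one (ξ := (z : ℂ)) (by
    rw [← Units.val_pow_eq_pow_val, hz, Units.val_one])
  exact ⟨i • 1, by rw [AddChar.map_nsmul_eq_pow, hi]⟩

theorem AddChar.map_sum_eq_prod {ι R M : Type*} [AddCommMonoid R] [CommMonoid M] (ψ : AddChar R M)
    (s : Finset ι) (f : ι → R) : ψ (∑ i ∈ s, f i) = ∏ i ∈ s, ψ (f i) := by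
  classical
  induction s using Finset.induction_on with
  | empty => simp
  | insert a s ha ih => rw [Finset.sum_insert ha, Finset.prod_insert ha, map_add_eq_mul, ih]

theorem ZMod.val_nsmul_eq_smul {p : ℕ} [NeZero p] {W : Type*} [AddCommGroup W] [Module (ZMod p) W]
    (c : ZMod p) (w : W) : c.val • w = c • w := by
  rw [← Nat.cast_smul_eq_nsmul (ZMod p), ZMod.natCast_zmod_val]

theorem ZMod.exists_basis_nsmul (p : ℕ) [Fact p.Prime] (W : Type*) [AddCommGroup W]
    [Module (ZMod p) W] [Finite W] :
    ∃ (r : ℕ) (w : Fin r → W), Nat.card W = p ^ r ∧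
      (∀ c : Fin r → ZMod p, ∑ a, (c a).val • w a = 0 → c = 0) ∧
      ∀ x, ∃ c : Fin r → ZMod p, ∑ a, (c a).val • w a = x := by
  have : Module.Finite (ZMod p) W := Module.Finite.of_finite
  let B := Module.finBasis (ZMod p) W
  simp only [ZMod.val_nsmul_eq_smul]
  refine ⟨_, B, ?_, ?_, fun x => ⟨B.repr x, B.sum_repr x⟩⟩
  · rw [Nat.card_congr B.equivFun.toEquiv]
    simp
  · intro c hc
    exact funext fun a => Fintype.linearIndependent_iff.1 B.linearIndependent c hc a

/-- If all elements of a finite abelian group satisfy `x ^ p = 1`, it has a basis over `ZMod p`. -/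
theorem CommGroup.exists_basis_of_pow_eq_one {p : ℕ} [Fact p.Prime] (W : Type*) [CommGroup W]
    [Finite W] (hW : ∀ x : W, x ^ p = 1) :
    ∃ (r : ℕ) (w : Fin r → W), Nat.card W = p ^ r ∧
      (∀ c : Fin r → ZMod p, ∏ a, w a ^ (c a).val = 1 → c = 0) ∧
      ∀ x, ∃ c : Fin r → ZMod p, ∏ a, w a ^ (c a).val = x := by
  let m : @Module (ZMod p) (Additive W) _ AddCommGroup.toAddCommMonoid :=
    AddCommGroup.zmodModule fun x => hW x.toMul
  exact @ZMod.exists_basis_nsmul p _ (Additive W) _ m _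

/-- In a nontrivial finite abelian `p`-group the exponent is `p * q` for some `q`. -/
theorem IsPGroup.exists_pow_ne_one_pow_mul_eq_one {p : ℕ} [Fact p.Prime] {V : Type*} [CommGroup V]
    [Finite V] [Nontrivial V] (hV : IsPGroup p V) :
    ∃ q : ℕ, (∃ x : V, x ^ q ≠ 1) ∧ ∀ x : V, x ^ (q * p) = 1 := by
  classical
  obtain ⟨n, hn⟩ := IsPGroup.iff_card.1 hV
  have hex : ∃ e, ∀ x : V, x ^ p ^ e = 1 := ⟨n, fun x => by rw [← hn, pow_card_eq_one']⟩
  have hne : Nat.find hex ≠ 0 := by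
    intro h0
    obtain ⟨x, hx⟩ := exists_ne (1 : V)
    have := Nat.find_spec hex x
    rw [h0, pow_zero, pow_one] at this
    exact hx this
  obtain ⟨e, he⟩ := Nat.exists_eq_succ_of_ne_zero hne
  refine ⟨p ^ e, ?_, ?_⟩
  · have := Nat.find_min hex (m := e) (by omega)
    push Not at this
    exact this
  · have := Nat.find_spec hex
    rwa [he, pow_succ] at this

/-- Since `V` need not be elementary abelian, the matrices come from the pairing `(x^q, y) ↦ l (b
(x^q) y)`, where `V` has exponent `p * q`. It takes values in `p`-th roots of unity and depends only
on `x^q` and `y^q`, so it is an alternating form on `V^q`, a space over `ZMod p`. -/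
theorem card_sq_le_of_nondegenerate {p : ℕ} [Fact p.Prime] {V D : Type*} [CommGroup V] [Finite V]
    [CommGroup D] [Finite D] [Nontrivial V] (hV : IsPGroup p V) (b : V →* V →* D)
    (halt : ∀ x, b x x = 1) (A : Subgroup D)
    (h : ∀ l : D →* ℂˣ, (∃ a ∈ A, l a ≠ 1) → ∀ x, (∀ y, l (b x y) = 1) → x = 1) :
    Nat.card A ^ 2 ≤ Nat.card V := by
  have hanti : ∀ x y, b x y * b y x = 1 := by
    intro x y
    have := halt (x * y)
    simpa [halt] using this
  have hpow : ∀ φ : A →* ℂˣ, φ ^ p = 1 := by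
    intro φ
    obtain ⟨l, rfl⟩ := MonoidHom.domRestrict_surjective ℂ A φ
    -- If `l ^ p` were nontrivial on `A`, it would be nondegenerate; but an element `x` of order `p`
    -- lies in its radical, as `l(b(x,y))^p = l(b(x^p,y)) = 1`.
    by_contra hne
    obtain ⟨a, ha⟩ := DFunLike.ne_iff.1 hne
    have hp : p ∣ Nat.card V := by
      obtain ⟨n, hn⟩ := IsPGroup.iff_card.1 hV
      rw [hn]
      refine dvd_pow_self p ?_
      rintro rfl
      exact Finite.one_lt_card.ne' (by simpa using hn)
    obtain ⟨x, hx⟩ := exists_prime_orderOf_dvd_card' p hp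
    have : x = 1 := h (l ^ p) ⟨a, a.2, ha⟩ x fun y => by
      rw [MonoidHom.pow_apply, ← map_pow, ← MonoidHom.pow_apply, ← map_pow, ← hx,
        pow_orderOf_eq_one, map_one, MonoidHom.one_apply, map_one]
    rw [this, orderOf_one] at hx
    exact (Fact.out : p.Prime).one_lt.ne hx
  obtain ⟨k, φ, hk, hφ, -⟩ := CommGroup.exists_basis_of_pow_eq_one (A →* ℂˣ) hpow
  rw [CommGroup.card_monoidHom_of_hasEnoughRootsOfUnity] at hk
  choose l hl using fun j => MonoidHom.domRestrict_surjective ℂ A (φ j)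
  obtain ⟨q, ⟨x₀, hx₀⟩, hq⟩ := hV.exists_pow_ne_one_pow_mul_eq_one
  obtain ⟨r, w, hr, hw, hspan⟩ := CommGroup.exists_basis_of_pow_eq_one (p := p)
    (powMonoidHom q : V →* V).range (by
      rintro ⟨_, x, rfl⟩
      exact Subtype.ext (by simpa [← pow_mul] using hq x))
  choose v hv using fun a => (w a).2
  replace hv : ∀ a, v a ^ q = w a := hv
  have hrpos : 0 < r := by
    rw [Nat.pos_iff_ne_zero]
    rintro rfl
    rw [pow_zero, Nat.card_eq_one_iff_unique] at hr
    exact hx₀ (Subtype.ext_iff.1 (hr.1.elim ⟨x₀ ^ q, x₀, rfl⟩ 1))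
  have hM : ∀ j a c, ∃ m : ZMod p, ZMod.stdAddChar m = (l j (b (w a) (v c)) : ℂ) := fun j a c =>
    ZMod.exists_stdAddChar_eq (by
      rw [← map_pow, ← MonoidHom.pow_apply, ← map_pow, ← hv, ← pow_mul, hq]; simp)
  choose M hM using hM
  have hbq : ∀ x y, b (x ^ q) y = b x (y ^ q) := by intro x y; simp
  have hMinj := ZMod.injective_stdAddChar (N := p)
  have hkr : 2 * k ≤ r := by
    refine Matrix.two_mul_le_of_isAlt_of_det_ne_zero hrpos (fun j => Matrix.of (M j)) ?_ ?_ ?_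
    · intro j a
      refine hMinj ?_
      rw [Matrix.of_apply, hM, ← hv]
      simp [halt]
    · intro j a c
      rw [← add_eq_zero_iff_eq_neg]
      refine hMinj ?_
      rw [Matrix.of_apply, Matrix.of_apply, AddChar.map_add_eq_mul, hM, hM, ← hv, ← hv, hbq,
        hv, AddChar.map_zero_eq_one, ← Units.val_mul, ← map_mul, hanti, map_one, Units.val_one]
    · intro t ht hdet
      -- A kernel vector `c` of the combination `t` yields an element `wc` in the radical of the
      -- character `lt`, which is nontrivial on `A`.
      obtain ⟨c, hc, hc0⟩ := Matrix.exists_vecMul_eq_zero_iff.2 hdet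
      let lt : D →* ℂˣ := ∏ j, l j ^ (t j).val
      let wc : (powMonoidHom q : V →* V).range := ∏ a, w a ^ (c a).val
      obtain ⟨x, hx⟩ := wc.2
      replace hx : x ^ q = wc := hx
      have hlt : ∃ a ∈ A, lt a ≠ 1 := by
        by_contra! hcon
        refine ht (hφ t (MonoidHom.ext fun a => ?_))
        simp only [← hl]
        simpa [lt] using hcon a a.2
      have hval : ∀ d, lt (b wc (v d)) = 1 := by
        intro d
        have h1 := congrFun hc0 d
        apply Units.ext
        rw [Units.val_one, ← AddChar.map_zero_eq_one (ZMod.stdAddChar (N := p)), ← h1.trans (Pi.zero_apply d)]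
        have h2 : Matrix.vecMul c (∑ j, t j • Matrix.of (M j)) d
            = ∑ a, ∑ j, ((c a).val * (t j).val) • M j a d := by
          simp only [Matrix.vecMul, dotProduct, Matrix.sum_apply, Matrix.smul_apply,
            Finset.mul_sum, Matrix.of_apply]
          refine Finset.sum_congr rfl fun a _ => Finset.sum_congr rfl fun j _ => ?_
          rw [nsmul_eq_mul, Nat.cast_mul, ZMod.natCast_zmod_val, ZMod.natCast_zmod_val,
            smul_eq_mul, mul_assoc]
        rw [h2]
        simp only [AddChar.map_sum_eq_prod, AddChar.map_nsmul_eq_pow, hM]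
        simp only [lt, wc, Subgroup.val_finsetProd, map_prod, MonoidHom.finsetProd_apply,
          Units.coe_prod, map_pow, MonoidHom.pow_apply, Units.val_pow_eq_pow_val,
          SubmonoidClass.coe_pow]
        refine Finset.prod_congr rfl fun a _ => ?_
        rw [← Finset.prod_pow]
        exact Finset.prod_congr rfl fun j _ => by rw [← pow_mul, mul_comm]
      -- The `v d` need not generate `V`, but `wc` is a `q`-th power, so only `y ^ q` matters.
      have hall : ∀ y, lt (b wc y) = 1 := by
        intro y
        obtain ⟨e, he⟩ := hspan ⟨y ^ q, y, rfl⟩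
        have hy : y ^ q = (∏ a, v a ^ (e a).val) ^ q := by
          rw [← Finset.prod_pow]
          have := congrArg Subtype.val he
          rw [Subgroup.val_finsetProd] at this
          refine this.symm.trans ?_
          refine Finset.prod_congr rfl fun a _ => ?_
          rw [SubmonoidClass.coe_pow, ← hv, pow_right_comm]
        rw [← hx, hbq, hy, ← hbq, hx]
        simp [hval]
      have : (wc : V) = 1 := h lt hlt _ hall
      exact hc (hw c (Subtype.ext this))
  calc Nat.card A ^ 2 = p ^ (2 * k) := by rw [hk, ← pow_mul, mul_comm]
    _ ≤ p ^ r := Nat.pow_le_pow_right (Fact.out : p.Prime).pos hkr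
    _ = Nat.card (powMonoidHom q : V →* V).range := hr.symm
    _ ≤ Nat.card V := Subgroup.card_le_card_group _

/-! ### Traces and irreducible representations -/

/-- The eigenvalues are roots of unity, so equality in the triangle inequality makes them all equal
to some `c`. Then `T - c` is nilpotent by Cayley–Hamilton and semisimple because `X ^ N - 1` is
separable, hence zero. -/
theorem Module.End.eq_smul_one_of_norm_trace_eq {V : Type*} [AddCommGroup V] [Module ℂ V]
    [FiniteDimensional ℂ V] {T : Module.End ℂ V} {N : ℕ} (hN : N ≠ 0) (hT : T ^ N = 1)
    (htr : ‖LinearMap.trace ℂ V T‖ = Module.finrank ℂ V) : ∃ c : ℂ, T = c • 1 := by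
  have hsplit : T.charpoly.Splits := IsAlgClosed.splits _
  have hcard : T.charpoly.roots.card = Module.finrank ℂ V := by
    rw [← hsplit.natDegree_eq_card_roots, LinearMap.charpoly_natDegree]
  rw [Module.End.trace_eq_sum_roots_charpoly_of_splits hsplit, ← hcard] at htr
  have hroot : ∀ r ∈ T.charpoly.roots, ‖r‖ = 1 := by
    intro r hr
    have h1 : T.HasEigenvalue r :=
      (Module.End.hasEigenvalue_iff_isRoot_charpoly T r).2 (Polynomial.isRoot_of_mem_roots hr)
    obtain ⟨v, hv⟩ := h1.exists_hasEigenvector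
    have h2 := hv.pow_apply N
    rw [hT, Module.End.one_apply] at h2
    have h3 : r ^ N = 1 := by
      refine smul_left_injective ℂ hv.2 ?_
      simp only [one_smul]
      exact h2.symm
    exact Complex.norm_eq_one_of_pow_eq_one h3 hN
  obtain ⟨c, hc⟩ : ∃ c, ∀ r ∈ T.charpoly.roots, r = c := by
    generalize T.charpoly.roots = R at *
    rcases eq_or_ne R.card 0 with h0 | h0
    · rw [Multiset.card_eq_zero] at h0
      exact ⟨0, by simp [h0]⟩
    let n : ℝ := R.card
    have hn : n ≠ 0 := Nat.cast_ne_zero.2 h0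
    let c : ℂ := R.sum / n
    have hcn : ‖c‖ = 1 := by
      simp only [c, norm_div, htr, Complex.norm_real, n, Real.norm_natCast]
      exact div_self hn
    have hle : ∀ r ∈ R, (starRingEnd ℂ c * r).re ≤ 1 := fun r hr =>
      (Complex.re_le_norm _).trans (by simp [hcn, hroot r hr])
    refine ⟨c, fun r hr => ?_⟩
    have hre : (starRingEnd ℂ c * r).re = 1 := by
      by_contra hne
      have hlt := Multiset.sum_lt_sum hle ⟨r, hr, lt_of_le_of_ne (hle r hr) hne⟩
      have h1 : (R.map fun r => (starRingEnd ℂ c * r).re).sum = (starRingEnd ℂ c * R.sum).re :=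
        (map_multiset_sum (Complex.reAddGroupHom.comp
          (AddMonoidHom.mulLeft (starRingEnd ℂ c))) R).symm
      have h2 : R.sum = c * n := by
        simp only [c]
        rw [div_mul_cancel₀]
        exact_mod_cast hn
      rw [h1, h2, ← mul_assoc, mul_comm _ c, Complex.mul_conj, Complex.normSq_eq_norm_sq, hcn] at hlt
      simp [n] at hlt
    have hnorm : ‖starRingEnd ℂ c * r‖ = 1 := by simp [hcn, hroot r hr]
    have h1 : starRingEnd ℂ c * r = 1 := by
      have := Complex.re_eq_norm.1 (hre.trans hnorm.symm)
      apply Complex.ext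
      · simpa using hre
      · simpa using this.2.symm
    calc r = c * (starRingEnd ℂ c * r) := by
          rw [← mul_assoc, Complex.mul_conj, Complex.normSq_eq_norm_sq, hcn]; simp
      _ = c := by rw [h1, mul_one]
  refine ⟨c, sub_eq_zero.1 (Module.End.eq_zero_of_isNilpotent_isSemisimple ?_ ?_)⟩
  · refine ⟨T.charpoly.roots.card, ?_⟩
    have h1 := hsplit.eq_prod_roots_of_monic T.charpoly_monic
    rw [Multiset.eq_replicate_card.2 hc, Multiset.map_replicate, Multiset.prod_replicate] at h1
    have h2 := T.aeval_self_charpoly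
    rw [h1] at h2
    simpa [Algebra.algebraMap_eq_smul_one] using h2
  · rw [← Algebra.algebraMap_eq_smul_one, Module.End.isSemisimple_sub_algebraMap_iff]
    refine Module.End.isSemisimple_of_squarefree_aeval_eq_zero (p := Polynomial.X ^ N - 1) ?_ ?_
    · exact (Polynomial.X_pow_sub_one_separable_iff.2 (Nat.cast_ne_zero.2 hN)).squarefree
    · simp [hT]

/-- Every nonzero finite-dimensional representation contains an irreducible one. -/
theorem Representation.exists_isIrreducible_embedding {G V : Type*} [Group G] [AddCommGroup V]
    [Module ℂ V] [FiniteDimensional ℂ V] [Nontrivial V] (ρ : Representation ℂ G V) :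
    ∃ (m : ℕ) (σ : Representation ℂ G (Fin m → ℂ)) (f : (Fin m → ℂ) →ₗ[ℂ] V), σ.IsIrreducible ∧
      Function.Injective f ∧ ∀ g v, f (σ g v) = ρ g (f v) := by
  classical
  -- A nonzero subrepresentation of least dimension is irreducible.
  have hex : ∃ m, 0 < m ∧ ∃ U : Subrepresentation ρ, Module.finrank ℂ U.toSubmodule = m :=
    ⟨_, Module.finrank_pos (R := ℂ) (M := V), ⊤, finrank_top ℂ V⟩
  obtain ⟨hpos, U, hU⟩ := Nat.find_spec hex
  have hmin : ∀ U' : Subrepresentation ρ, U'.toSubmodule ≠ ⊥ →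
      Nat.find hex ≤ Module.finrank ℂ U'.toSubmodule := fun U' hU' =>
    Nat.find_min' hex ⟨Nat.pos_of_ne_zero fun h => hU' (Submodule.finrank_eq_zero.1 h), U', rfl⟩
  generalize Nat.find hex = m at *
  let e : U.toSubmodule ≃ₗ[ℂ] (Fin m → ℂ) := (Module.finBasisOfFinrankEq ℂ _ hU).equivFun
  let σ : Representation ℂ G (Fin m → ℂ) :=
    { toFun := fun g => e.conj (U.toRepresentation g)
      map_one' := by rw [map_one]; exact e.conj_id
      map_mul' := fun g h => by rw [map_mul]; exact e.conj_comp _ _ }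
  let f : (Fin m → ℂ) →ₗ[ℂ] V := U.toSubmodule.subtype ∘ₗ e.symm.toLinearMap
  have hf : Function.Injective f := Subtype.val_injective.comp e.symm.injective
  have hfσ : ∀ g v, f (σ g v) = ρ g (f v) := by
    intro g v
    simp only [f, σ, MonoidHom.coe_mk, OneHom.coe_mk, LinearMap.comp_apply, LinearEquiv.conj_apply,
      LinearEquiv.coe_coe, LinearEquiv.symm_apply_apply]
    rfl
  have : Nonempty (Fin m) := ⟨⟨0, hpos⟩⟩
  have hnt : Nontrivial (Subrepresentation σ) := by
    refine ⟨⊥, ⊤, fun h => ?_⟩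
    have := congrArg Subrepresentation.toSubmodule h
    exact bot_ne_top this
  refine ⟨m, σ, f, ⟨fun τ => ?_⟩, hf, hfσ⟩
  rw [or_iff_not_imp_left]
  intro hτ
  have hτ' : τ.toSubmodule ≠ ⊥ := fun h => hτ (Subrepresentation.toSubmodule_injective h)
  let U' : Subrepresentation ρ := ⟨τ.toSubmodule.map f, by
    rintro g _ ⟨v, hv, rfl⟩
    exact ⟨σ g v, τ.apply_mem_toSubmodule g hv, hfσ g v⟩⟩
  have h1 := hmin U' fun h => 
    hτ' (Submodule.map_injective_of_injective hf (h.trans (Submodule.map_bot f).symm))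
  have h2 : Module.finrank ℂ U'.toSubmodule = Module.finrank ℂ τ.toSubmodule :=
    (Submodule.equivMapOfInjective f hf _).finrank_eq.symm
  refine Subrepresentation.toSubmodule_injective (Submodule.eq_top_of_finrank_eq ?_)
  refine le_antisymm (Submodule.finrank_le _) ?_
  rw [← h2, Module.finrank_fin_fun]
  exact h1

/-- The right regular representation on functions. -/
def Representation.rightTranslation (G : Type*) [Group G] : Representation ℂ G (G → ℂ) where
  toFun g := LinearMap.funLeft ℂ ℂ (· * g)
  map_one' := by ext; simp [LinearMap.funLeft]
  map_mul' g h := by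
    refine LinearMap.ext fun f => funext fun x => ?_
    simp [LinearMap.funLeft_apply, mul_assoc]

/-- Every linear character of the center lies under an irreducible representation. -/
theorem Representation.exists_isIrreducible_of_center_character {G : Type*} [Group G] [Finite G]
    (l : Subgroup.center G →* ℂˣ) :
    ∃ (m : ℕ) (σ : Representation ℂ G (Fin m → ℂ)), σ.IsIrreducible ∧
      ∀ z : Subgroup.center G, σ z = (l z : ℂ) • 1 := by
  classical
  let U : Subrepresentation (rightTranslation G) :=
    { toSubmodule :=
        { carrier := {f | ∀ (z : Subgroup.center G) x, f (x * z) = l z * f x}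
          add_mem' := fun {a b} ha hb z x => by simp [ha z x, hb z x, mul_add]
          zero_mem' := fun z x => by simp
          smul_mem' := fun c f hf z x => by simp [hf z x, mul_left_comm] }
      apply_mem_toSubmodule := fun g f hf z x => by
        change f (x * z * g) = l z * f (x * g)
        rw [mul_assoc, ← Subgroup.mem_center_iff.1 z.2 g, ← mul_assoc]
        exact hf z _ }
  -- Extending `l` by zero off the center shows that the `l`-isotypic part `U` is nonzero.
  let f₀ : G → ℂ := fun x => if h : x ∈ Subgroup.center G then l ⟨x, h⟩ else 0
  have hf₀ : f₀ ∈ U.toSubmodule := by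
    intro z x
    by_cases hx : x ∈ Subgroup.center G
    · have h1 : x * z ∈ Subgroup.center G := mul_mem hx z.2
      have h2 : (⟨x * z, h1⟩ : Subgroup.center G) = z * ⟨x, hx⟩ :=
        Subtype.ext (Subgroup.mem_center_iff.1 z.2 x)
      simp only [f₀, dif_pos hx, dif_pos h1, h2, map_mul, Units.val_mul]
    · have h1 : x * z ∉ Subgroup.center G := fun h => hx ((Subgroup.mul_mem_cancel_right _ z.2).1 h)
      simp only [f₀, dif_neg hx, dif_neg h1, mul_zero]
  have : Nontrivial U.toSubmodule := by
    refine ⟨⟨f₀, hf₀⟩, 0, fun h => ?_⟩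
    have := congrFun (congrArg Subtype.val h) 1
    have h2 : f₀ 1 = l 1 := dif_pos (one_mem _)
    simp [h2] at this
  obtain ⟨m, σ, f, hirr, hf, hfσ⟩ := U.toRepresentation.exists_isIrreducible_embedding
  refine ⟨m, σ, hirr, fun z => LinearMap.ext fun v => hf ?_⟩
  rw [hfσ]
  refine Subtype.ext (funext fun x => ?_)
  rw [LinearMap.smul_apply, Module.End.one_apply, map_smul]
  exact (f v).2 z x

/-- An element acting trivially in all irreducible representations is trivial. -/
theorem Representation.eq_one_of_forall_isIrreducible {G : Type*} [Group G] [Finite G] {z : G}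
    (hz : ∀ (m : ℕ) (σ : Representation ℂ G (Fin m → ℂ)), σ.IsIrreducible → σ z = 1) : z = 1 := by
  classical
  let N : Set G :=
    {z | ∀ (m : ℕ) (σ : Representation ℂ G (Fin m → ℂ)), σ.IsIrreducible → σ z = 1}
  have hN : ∀ g, ∀ z ∈ N, g⁻¹ * z * g ∈ N := fun g z hz m σ hσ => by
    rw [map_mul, map_mul, hz m σ hσ, mul_one, ← map_mul, inv_mul_cancel, map_one]
  let ρ := rightTranslation G
  let U : Subrepresentation ρ :=
    { toSubmodule :=
        { carrier := {v | ∀ z ∈ N, ρ z v = v}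
          add_mem' := fun {a b} ha hb z hz => by rw [map_add, ha z hz, hb z hz]
          zero_mem' := fun z _ => map_zero _
          smul_mem' := fun c v hv z hz => by rw [map_smul, hv z hz] }
      apply_mem_toSubmodule := fun g v hv z hz => by
        have h := hv _ (hN g z hz)
        have h2 : ρ z (ρ g v) = ρ g (ρ (g⁻¹ * z * g) v) := by
          simp only [← Module.End.mul_apply, ← map_mul]
          congr 2
          group
        rw [h2, h] }
  obtain ⟨C, hC⟩ := exists_isCompl U
  -- `N` fixes every irreducible constituent of the complement `C`, which would thus lie in `U`.
  have hCbot : C.toSubmodule = ⊥ := by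
    by_contra hne
    have : Nontrivial C.toSubmodule := Submodule.nontrivial_iff_ne_bot.2 hne
    obtain ⟨m, σ, f, hirr, hf, hfσ⟩ := C.toRepresentation.exists_isIrreducible_embedding
    have hfU : ∀ v, ((f v : C.toSubmodule) : G → ℂ) ∈ U.toSubmodule := by
      intro v z hz
      have h := hfσ z v
      rw [hz m σ hirr, Module.End.one_apply] at h
      exact (congrArg Subtype.val h).symm
    have hzero : ∀ v : Fin m → ℂ, v = 0 := by
      intro v
      have h1 : ((f v : C.toSubmodule) : G → ℂ) ∈ (U ⊓ C).toSubmodule := ⟨hfU v, (f v).2⟩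
      rw [hC.inf_eq_bot] at h1
      refine hf ?_
      rw [map_zero]
      exact Subtype.ext h1
    obtain ⟨a, b, hab⟩ := hirr.toNontrivial
    refine hab (Subrepresentation.toSubmodule_injective (Submodule.ext fun v => ?_))
    simp [hzero v]
  have htop : U = ⊤ := by
    have : C = ⊥ := Subrepresentation.toSubmodule_injective hCbot
    rw [← hC.sup_eq_top, this, sup_bot_eq]
  have h1 : Pi.single 1 1 ∈ U.toSubmodule := by rw [htop]; exact Submodule.mem_top
  have h2 := congrFun (h1 z hz) 1
  by_contra hne
  have h3 : (Pi.single 1 1 : G → ℂ) (1 * z) = (Pi.single 1 1 : G → ℂ) 1 := h2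
  simp [hne] at h3

/-! ### Centers of irreducible characters -/

section

open scoped commutatorElement

open Representation in
theorem Representation.IsIrreducible.exists_eq_smul_one {G : Type*} [Group G] {m : ℕ}
    {σ : Representation ℂ G (Fin m → ℂ)} (hσ : σ.IsIrreducible) {g : G}
    (hg : ∀ h, σ ⁅g, h⁆ = 1) : ∃ c : ℂ, σ g = c • 1 := by
  have hcomm : ∀ h, σ g * σ h = σ h * σ g := fun h => by
    have h1 : g * h = ⁅g, h⁆ * (h * g) := by rw [commutatorElement_def]; group
    rw [← map_mul, h1, map_mul, hg, one_mul, map_mul]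
  let f : IntertwiningMap σ σ := { toLinearMap := σ g, isIntertwining' := hcomm }
  obtain ⟨c, hc⟩ := (IsIrreducible.algebraMap_intertwiningMap_bijective_of_isAlgClosed
    (ρ := σ)).2 f
  refine ⟨c, ?_⟩
  have := congrArg IntertwiningMap.toLinearMap hc
  exact this.symm

namespace NestedGroup

/-- Both sides say that `g` acts as a scalar: the left by the trace criterion, the right by Schur's
lemma. -/
theorem mem_charCenter_iff {G : Type*} [Group G] [Finite G] {m : ℕ}
    {σ : Representation ℂ G (Fin m → ℂ)} (hσ : σ.IsIrreducible) (g : G) :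
    g ∈ charCenter σ.character ↔ ∀ h, σ ⁅g, h⁆ = 1 := by
  have hchar : g ∈ charCenter σ.character ↔
      ‖LinearMap.trace ℂ _ (σ g)‖ = Module.finrank ℂ (Fin m → ℂ) := by
    rw [charCenter, Set.mem_ofPred_eq, Representation.char_one, ← Complex.ofReal_natCast,
      Complex.ofReal_inj]
    rfl
  have hN : Nat.card G ≠ 0 := Nat.card_pos.ne'
  have hpow : σ g ^ Nat.card G = 1 := by rw [← map_pow, pow_card_eq_one', map_one]
  rw [hchar]
  constructor
  · intro h x
    obtain ⟨c, hc⟩ := Module.End.eq_smul_one_of_norm_trace_eq hN hpow h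
    have hcomm : σ g * σ x = σ x * σ g := by rw [hc, smul_mul_assoc, mul_smul_comm, one_mul, mul_one]
    rw [commutatorElement_def, map_mul, map_mul, map_mul, hcomm, mul_assoc (σ x), ← map_mul σ g,
      mul_inv_cancel, map_one, mul_one, ← map_mul, mul_inv_cancel, map_one]
  · intro h
    obtain ⟨c, hc⟩ := hσ.exists_eq_smul_one h
    rcases Nat.eq_zero_or_pos m with rfl | hm
    · simp [Subsingleton.elim (σ g) 0]
    have : Nonempty (Fin m) := ⟨⟨0, hm⟩⟩
    rw [hc, smul_pow, one_pow] at hpow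
    have hcN : c ^ Nat.card G = 1 := by
      have := congrFun (LinearMap.congr_fun hpow 1) ⟨0, hm⟩
      simpa using this
    rw [hc, map_smul, LinearMap.trace_one, norm_smul, Complex.norm_eq_one_of_pow_eq_one hcN hN]
    simp

theorem IsChainOfCenters.last_le_center {G : Type*} [Group G] [Finite G] {n : ℕ}
    {X : Fin (n + 1) → Subgroup G} (hX : IsChainOfCenters X) :
    X (Fin.last n) ≤ Subgroup.center G := by
  intro x hx
  rw [Subgroup.mem_center_iff]
  intro h
  refine (commutatorElement_eq_one_iff_mul_comm.1
    (Representation.eq_one_of_forall_isIrreducible fun m σ hσ => ?_)).symm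
  obtain ⟨i, hi⟩ := hX.exists_eq_of_mem_irr _ ⟨m, σ, hσ, rfl⟩
  refine (mem_charCenter_iff hσ x).1 ?_ h
  rw [hi]
  exact hX.strictAnti.antitone (Fin.le_last i) hx

/-- Take an irreducible representation over `l`: commutators act in it through `l`, so its center is
the radical of `l([x,y])`. -/
theorem IsChainOfCenters.exists_mem_iff {G : Type*} [Group G] [Finite G] {n : ℕ}
    {X : Fin (n + 1) → Subgroup G} (hX : IsChainOfCenters X)
    (hcomm : ∀ x y : G, ⁅x, y⁆ ∈ Subgroup.center G) (l : Subgroup.center G →* ℂˣ) :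
    ∃ i, ∀ x, x ∈ X i ↔ ∀ y, l ⟨⁅x, y⁆, hcomm x y⟩ = 1 := by
  obtain ⟨m, σ, hσ, hl⟩ := Representation.exists_isIrreducible_of_center_character l
  obtain ⟨i, hi⟩ := hX.exists_eq_of_mem_irr _ ⟨m, σ, hσ, rfl⟩
  refine ⟨i, fun x => ?_⟩
  rw [← SetLike.mem_coe, ← hi, mem_charCenter_iff hσ]
  refine forall_congr' fun y => ?_
  rw [hl ⟨⁅x, y⁆, hcomm x y⟩]
  obtain ⟨a, b, hab⟩ := hσ.toNontrivial
  have hm : 0 < m := by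
    rw [Nat.pos_iff_ne_zero]
    rintro rfl
    exact hab (Subrepresentation.toSubmodule_injective (Subsingleton.elim _ _))
  constructor
  · intro h
    have := congrFun (LinearMap.congr_fun h 1) ⟨0, hm⟩
    exact Units.ext (by simpa using this)
  · intro h
    rw [h, Units.val_one, one_smul]

end NestedGroup

/-! ### Commutator calculus in class two -/

theorem Subgroup.relIndex_last_eq_prod {G : Type*} [Group G] {n : ℕ}
    (f : Fin (n + 1) → Subgroup G) (hf : Antitone f) :
    (f (Fin.last n)).relIndex (f 0) = ∏ i : Fin n, (f i.succ).relIndex (f i.castSucc) := by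
  induction n with
  | zero => simp
  | succ n ih =>
    have h := ih (fun i => f i.castSucc) fun i j hij => hf (Fin.castSucc_le_castSucc_iff.2 hij)
    rw [Fin.prod_univ_castSucc, ← Subgroup.relIndex_mul_relIndex _ (f (Fin.last n).castSucc) _
      (hf (Fin.le_last _)) (hf (Fin.zero_le _)), mul_comm]
    rw [Fin.castSucc_zero] at h
    rw [h]
    rfl

theorem commutatorElement_mul_left_of_central {G : Type*} [Group G]
    (hcomm : ∀ x y : G, ⁅x, y⁆ ∈ Subgroup.center G) (x y z : G) :
    ⁅x * y, z⁆ = ⁅x, z⁆ * ⁅y, z⁆ := by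
  have h := Subgroup.mem_center_iff.1 (hcomm y z) x
  have h1 : ⁅x * y, z⁆ = x * ⁅y, z⁆ * (z * x⁻¹ * z⁻¹) := by
    simp only [commutatorElement_def]; group
  rw [h1, h, mul_assoc, ← Subgroup.mem_center_iff.1 (hcomm y z)]
  congr 1
  simp only [commutatorElement_def]; group

theorem commutatorElement_mul_right_of_central {G : Type*} [Group G]
    (hcomm : ∀ x y : G, ⁅x, y⁆ ∈ Subgroup.center G) (x y z : G) :
    ⁅x, y * z⁆ = ⁅x, y⁆ * ⁅x, z⁆ := by
  rw [← commutatorElement_inv, commutatorElement_mul_left_of_central hcomm, mul_inv_rev,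
    commutatorElement_inv, commutatorElement_inv]
  exact Subgroup.mem_center_iff.1 (hcomm x y) _

/-- The commutator pairing of a group of class two descends along compatible surjections of its two
arguments and homomorphisms of its values. -/
theorem exists_commutator_pairing {G : Type*} [Group G]
    (hcomm : ∀ x y : G, ⁅x, y⁆ ∈ Subgroup.center G) {V D : Type*} [CommGroup V] [CommGroup D]
    (π : G →* V) (hπ : Function.Surjective π) (κ : Subgroup.center G →* D)
    (hκ : ∀ x ∈ π.ker, ∀ y, κ ⟨⁅x, y⁆, hcomm x y⟩ = 1) :
    ∃ b : V →* V →* D, ∀ x y, b (π x) (π y) = κ ⟨⁅x, y⁆, hcomm x y⟩ := by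
  let β : G →* G →* D :=
    MonoidHom.mk' (fun x => κ.comp
      (MonoidHom.mk' (fun y => ⟨⁅x, y⁆, hcomm x y⟩) fun y z =>
        Subtype.ext (commutatorElement_mul_right_of_central hcomm x y z)))
      fun x y => MonoidHom.ext fun z =>
        (congrArg κ (a₂ := ⟨⁅x, z⁆, hcomm x z⟩ * ⟨⁅y, z⁆, hcomm y z⟩)
          (Subtype.ext (commutatorElement_mul_left_of_central hcomm x y z))).trans (map_mul κ _ _)
  have hβ : ∀ x y, β x y = κ ⟨⁅x, y⁆, hcomm x y⟩ := fun _ _ => rfl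
  have h2 : ∀ x, ∀ y ∈ π.ker, β x y = 1 := fun x y hy => by
    have h : (⟨⁅x, y⁆, hcomm x y⟩ : Subgroup.center G) = ⟨⁅y, x⁆, hcomm y x⟩⁻¹ :=
      Subtype.ext (commutatorElement_inv y x).symm
    rw [hβ, h, map_inv, hκ y hy, inv_one]
  let γ : G → V →* D := fun x => (π.liftOfSurjective hπ) ⟨β x, fun y hy => h2 x y hy⟩
  have hγ : ∀ x y, γ x (π y) = β x y := fun x y =>
    MonoidHom.liftOfRightInverse_comp_apply π _ (Function.rightInverse_surjInv hπ) _ y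
  let γ' : G →* V →* D := MonoidHom.mk' γ fun x x' => by
    refine MonoidHom.ext fun v => ?_
    obtain ⟨y, rfl⟩ := hπ v
    rw [MonoidHom.mul_apply, hγ, hγ, hγ, map_mul, MonoidHom.mul_apply]
  have hγ' : π.ker ≤ γ'.ker := fun x hx => MonoidHom.ext fun v => by
    obtain ⟨y, rfl⟩ := hπ v
    exact (hγ x y).trans (hκ x hx y)
  refine ⟨(π.liftOfSurjective hπ) ⟨γ', hγ'⟩, fun x y => ?_⟩
  have : (π.liftOfSurjective hπ) ⟨γ', hγ'⟩ (π x) = γ' x :=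
    MonoidHom.liftOfRightInverse_comp_apply π _ (Function.rightInverse_surjInv hπ) ⟨γ', hγ'⟩ x
  rw [this]
  exact hγ x y

/-! ### The bound for one step of the chain -/

namespace NestedGroup

theorem IsChainOfCenters.card_map_commutator_sq_le {p : ℕ} [Fact p.Prime] {G : Type*} [Group G]
    [Finite G] (hG : IsPGroup p G) {n : ℕ} {X : Fin (n + 1) → Subgroup G} (hX : IsChainOfCenters X)
    (hcomm : ∀ x y : G, ⁅x, y⁆ ∈ Subgroup.center G) (i : Fin n) {V D : Type*} [CommGroup V]
    [CommGroup D] (π : G →* V) (hπ : Function.Surjective π) (hker : π.ker = X i.succ)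
    (κ : Subgroup.center G →* D) (hκ : Function.Surjective κ)
    (hκker : κ.ker = ⁅X i.succ, (⊤ : Subgroup G)⁆.subgroupOf (Subgroup.center G)) :
    Nat.card ((⁅X i.castSucc, (⊤ : Subgroup G)⁆.subgroupOf (Subgroup.center G)).map κ) ^ 2
      ≤ Nat.card V := by
  have : Finite V := Finite.of_surjective π hπ
  have : Finite D := Finite.of_surjective κ hκ
  have hone : ∀ x ∈ X i.succ, ∀ y, κ ⟨⁅x, y⁆, hcomm x y⟩ = 1 := fun x hx y => by
    rw [← MonoidHom.mem_ker, hκker]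
    exact Subgroup.commutator_mem_commutator hx (Subgroup.mem_top y)
  have : Nontrivial V := by
    by_contra hV
    rw [not_nontrivial_iff_subsingleton] at hV
    refine (hX.strictAnti i.castSucc_lt_succ).not_ge fun x _ => ?_
    rw [← hker]
    exact Subsingleton.elim _ _
  obtain ⟨b, hb⟩ := exists_commutator_pairing hcomm π hπ κ (by rwa [hker])
  refine card_sq_le_of_nondegenerate (hG.of_surjective π hπ) b ?_ _ ?_
  · intro v
    obtain ⟨x, rfl⟩ := hπ v
    rw [hb, ← map_one κ]
    exact congrArg κ (Subtype.ext (commutatorElement_self x))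
  · rintro l ⟨_, ⟨a, ha, rfl⟩, hla⟩
    obtain ⟨j, hj⟩ := hX.exists_mem_iff hcomm (l.comp κ)
    have hYj : X i.succ ≤ X j := fun x hx => (hj x).2 fun y => by
      rw [MonoidHom.comp_apply, hone x hx, map_one]
    have hXj : ¬ X i.castSucc ≤ X j := fun hle => hla <| by
      have hle' : ⁅X i.castSucc, (⊤ : Subgroup G)⁆ ≤
          (l.comp κ).ker.map (Subgroup.center G).subtype :=
        Subgroup.commutator_le.2 fun x hx y _ => ⟨⟨⁅x, y⁆, hcomm x y⟩, (hj x).1 (hle hx) y, rfl⟩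
      obtain ⟨a', ha', haa'⟩ := hle' ha
      obtain rfl : a' = a := Subtype.ext haa'
      exact ha'
    -- No term of the chain lies strictly between `X i.succ` and `X i.castSucc`.
    have hij : j = i.succ := by
      refine le_antisymm (hX.strictAnti.le_iff_ge.1 hYj) ?_
      rw [← Fin.castSucc_lt_iff_succ_le, ← not_le]
      exact fun h => hXj (hX.strictAnti.antitone h)
    intro v hv
    obtain ⟨x, rfl⟩ := hπ v
    rw [← MonoidHom.mem_ker, hker, ← hij]
    exact (hj x).2 fun y => by rw [MonoidHom.comp_apply, ← hb, hv]

theorem IsChainOfCenters.relIndex_sq_le {p : ℕ} (hp : p.Prime) {G : Type*} [Group G] [Finite G]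
    (hG : IsPGroup p G) {n : ℕ} {X : Fin (n + 1) → Subgroup G} (hX : IsChainOfCenters X)
    (hclass : commutator G ≤ X (Fin.last n)) (i : Fin n) :
    (⁅X i.succ, (⊤ : Subgroup G)⁆.relIndex ⁅X i.castSucc, (⊤ : Subgroup G)⁆) ^ 2
      ≤ (X i.succ).index := by
  have : Fact p.Prime := ⟨hp⟩
  have hcomm : ∀ x y : G, ⁅x, y⁆ ∈ Subgroup.center G := fun x y =>
    hX.last_le_center (hclass
      (Subgroup.commutator_mem_commutator (Subgroup.mem_top x) (Subgroup.mem_top y)))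
  have hGY : commutator G ≤ X i.succ := hclass.trans (hX.strictAnti.antitone (Fin.le_last _))
  have : (X i.succ).Normal := Subgroup.Normal.of_commutator_le G hGY
  let _ : CommGroup (G ⧸ X i.succ) :=
    { mul_comm := (Subgroup.Normal.quotient_commutative_iff_commutator_le.2 hGY).is_comm.comm }
  let N' := ⁅X i.succ, (⊤ : Subgroup G)⁆.subgroupOf (Subgroup.center G)
  have : N'.Normal := inferInstance
  let _ : CommGroup (Subgroup.center G ⧸ N') :=
    { mul_comm := by
        rintro ⟨x⟩ ⟨y⟩
        exact congrArg (QuotientGroup.mk' N') (Subtype.ext (Subgroup.mem_center_iff.1 y.2 x)) }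
  have h := hX.card_map_commutator_sq_le hG hcomm i (QuotientGroup.mk' (X i.succ))
    (QuotientGroup.mk'_surjective _) (QuotientGroup.ker_mk' _) (QuotientGroup.mk' N')
    (QuotientGroup.mk'_surjective _) (QuotientGroup.ker_mk' _)
  rwa [← Subgroup.relIndex_ker, QuotientGroup.ker_mk', Subgroup.relIndex_subgroupOf,
    ← Subgroup.index_eq_card] at h
  exact Subgroup.commutator_le.2 fun x _ y _ => hcomm x y

end NestedGroup

end

theorem mainTheorem8 (p : ℕ) (hp : p.Prime) (G : Type*) [Group G] [Finite G]
    (hG : IsPGroup p G) (hnonab : ¬ ∀ a b : G, a * b = b * a)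
    (hnested : NestedGroup.IsNested G)
    (n : ℕ) (X : Fin (n + 1) → Subgroup G) (hX : NestedGroup.IsChainOfCenters X)
    (hclass : commutator G ≤ X (Fin.last n))
    (d : Fin (n + 1) → ℝ) (hd_nonneg : ∀ i, 0 ≤ d i)
    (hd : ∀ i, d i ^ 2 = ((X i).index : ℝ)) :
    (∀ i : Fin n,
      ((⁅X i.succ, (⊤ : Subgroup G)⁆.relIndex ⁅X i.castSucc, (⊤ : Subgroup G)⁆ : ℕ) : ℝ)
        ≤ d i.succ) ∧
    (Nat.card (commutator G) : ℝ) ≤ ∏ i : Fin n, d i.succ := by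
  have hmain : ∀ i : Fin n,
      ((⁅X i.succ, (⊤ : Subgroup G)⁆.relIndex ⁅X i.castSucc, (⊤ : Subgroup G)⁆ : ℕ) : ℝ)
        ≤ d i.succ := fun i => by
    rw [← pow_le_pow_iff_left₀ (Nat.cast_nonneg _) (hd_nonneg _) two_ne_zero, hd]
    exact_mod_cast hX.relIndex_sq_le hp hG hclass i
  refine ⟨hmain, ?_⟩
  have hlast : ⁅X (Fin.last n), (⊤ : Subgroup G)⁆ = ⊥ := by
    rw [Subgroup.commutator_eq_bot_iff_le_centralizer, Subgroup.coe_top,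
      Subgroup.centralizer_univ]
    exact hX.last_le_center
  have hprod := Subgroup.relIndex_last_eq_prod (fun i => ⁅X i, (⊤ : Subgroup G)⁆)
    fun i j hij => Subgroup.commutator_mono (hX.strictAnti.antitone hij) le_rfl
  simp only [hlast, Subgroup.relIndex_bot_left, hX.zero_eq_top] at hprod
  rw [commutator_def, hprod, Nat.cast_prod]
  exact Finset.prod_le_prod (fun _ _ => Nat.cast_nonneg _) fun i _ => hmain i
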